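/- Let $k$ be a perfect field of characteristic $p>0$, let $m\ge 1$, and let $X=\mathbb{P}^m_k=\operatorname{Proj} k[x_0,\dots,x_m]$. Let $f:X\to X$ be the relative Frobenius endomorphism, i.e. the $k$-morphism induced by the $k$-algebra homomorphism $x_i\mapsto x_i^p$ of $k[x_0,\dots,x_m]$. For $n\ge 0$ put $e_n=1+p+\cdots+p^{n-1}=\frac{p^n-1}{p-1}$ and $F_n=\Gamma(X,\mathcal{O}_X(e_n))$. Identifying $f^*\mathcal{O}_X(d)$ with $\mathcal{O}_X(pd)$ by means of $x_i\mapsto x_i^p$, let $f^i(c)\in\Gamma(X,\mathcal{O}_X(p^ie_j))$ denote the pull-back of $c\in F_j$ along the $i$-th iterate of $f$. Let $F=\bigoplus_{n\ge 0}F_n$ be the twisted homogeneous coordinate ring: the graded $k$-algebra with product $$a\cdot c=a\,f^i(c)\in F_{i+j}\qquad (a\in F_i,\ c\in F_j).$$ 1. If $(p,m)\neq(2,1)$, then $F$ is not finitely generated as a $k$-algebra. 2. If $p=2$ and $m=1$, then $F$ is generated as a $k$-algebra by $F_1=\Gamma(X,\mathcal{O}_X(1))$, but $F$ is neither left noetherian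 nor right noetherian. -/

import Mathlib

open scoped DirectSum

noncomputable section

namespace FrobRing

universe u

/-! ### The sheaves `𝒪(d)` on `Proj` of a graded ring: global sections -/

section Twist

variable {k S : Type u} [CommRing k] [CommRing S] [Algebra k S]
variable (𝒜 : ℕ → Submodule k S) [GradedAlgebra 𝒜]

/-- The ring of all (not necessarily regular) functions `x ↦ s x ∈ S_x` on `Proj S`, where `S_x` is
the localization of `S` at the homogeneous prime `x`. -/
abbrev PointFun : Type u :=
  ∀ x : ProjectiveSpectrum 𝒜, Localization.AtPrime x.asHomogeneousIdeal.toIdeal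

/-- `s` is locally a fraction of degree `d`: every point has an open neighbourhood on which
`s = a / b` with `a`, `b` homogeneous, `deg a = d + deg b`, and `b` vanishing nowhere. -/
def IsLocallyFraction (d : ℕ) (s : PointFun 𝒜) : Prop :=
  ∀ x : ProjectiveSpectrum 𝒜, ∃ U : Set (ProjectiveSpectrum 𝒜), IsOpen U ∧ x ∈ U ∧
    ∃ (i : ℕ) (a b : S), a ∈ 𝒜 (d + i) ∧ b ∈ 𝒜 i ∧
      ∀ y ∈ U, ∃ hb : b ∈ y.asHomogeneousIdeal.toIdeal.primeCompl,
        s y = Localization.mk a ⟨b, hb⟩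

variable {𝒜}

theorem IsLocallyFraction.mul {d e : ℕ} {s t : PointFun 𝒜} (hs : IsLocallyFraction 𝒜 d s)
    (ht : IsLocallyFraction 𝒜 e t) : IsLocallyFraction 𝒜 (d + e) (s * t) := by
  intro x
  obtain ⟨U, hU, hxU, i, a, b, ha, hb, H⟩ := hs x
  obtain ⟨V, hV, hxV, j, a', b', ha', hb', H'⟩ := ht x
  refine ⟨U ∩ V, hU.inter hV, ⟨hxU, hxV⟩, i + j, a * a', b * b', ?_,
    SetLike.mul_mem_graded hb hb', ?_⟩
  · have := SetLike.mul_mem_graded ha ha'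
    rwa [show d + i + (e + j) = d + e + (i + j) by ring] at this
  · rintro y ⟨hy, hy'⟩
    obtain ⟨h1, h2⟩ := H y hy
    obtain ⟨h3, h4⟩ := H' y hy'
    refine ⟨mul_mem h1 h3, ?_⟩
    rw [Pi.mul_apply, h2, h4, Localization.mk_mul]
    rfl

/-- A homogeneous element of degree `d` is a global section of `𝒪(d)`. -/
theorem isLocallyFraction_algebraMap {d : ℕ} {a : S} (ha : a ∈ 𝒜 d) :
    IsLocallyFraction 𝒜 d (fun _ => algebraMap _ _ a) := by
  intro x
  refine ⟨Set.univ, isOpen_univ, trivial, 0, a, 1, by simpa using ha, SetLike.one_mem_graded 𝒜, ?_⟩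
  intro y _
  exact ⟨one_mem _, (Localization.mk_one_eq_algebraMap a).symm⟩

theorem IsLocallyFraction.add {d : ℕ} {s t : PointFun 𝒜} (hs : IsLocallyFraction 𝒜 d s)
    (ht : IsLocallyFraction 𝒜 d t) : IsLocallyFraction 𝒜 d (s + t) := by
  intro x
  obtain ⟨U, hU, hxU, i, a, b, ha, hb, H⟩ := hs x
  obtain ⟨V, hV, hxV, j, a', b', ha', hb', H'⟩ := ht x
  refine ⟨U ∩ V, hU.inter hV, ⟨hxU, hxV⟩, i + j, b * a' + b' * a, b * b', ?_,
    SetLike.mul_mem_graded hb hb', ?_⟩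
  · have h1 := SetLike.mul_mem_graded hb ha'
    have h2 := SetLike.mul_mem_graded hb' ha
    rw [show i + (d + j) = d + (i + j) by ring] at h1
    rw [show j + (d + i) = d + (i + j) by ring] at h2
    exact add_mem h1 h2
  · rintro y ⟨hy, hy'⟩
    obtain ⟨h1, h2⟩ := H y hy
    obtain ⟨h3, h4⟩ := H' y hy'
    refine ⟨mul_mem h1 h3, ?_⟩
    rw [Pi.add_apply, h2, h4, Localization.add_mk]
    rfl

theorem IsLocallyFraction.smul {d : ℕ} (c : k) {s : PointFun 𝒜} (hs : IsLocallyFraction 𝒜 d s) :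
    IsLocallyFraction 𝒜 d (c • s) := by
  intro x
  obtain ⟨U, hU, hxU, i, a, b, ha, hb, H⟩ := hs x
  refine ⟨U, hU, hxU, i, c • a, b, Submodule.smul_mem _ _ ha, hb, fun y hy => ?_⟩
  obtain ⟨h1, h2⟩ := H y hy
  refine ⟨h1, ?_⟩
  rw [Pi.smul_apply, h2, Localization.smul_mk]

variable (𝒜)

/-- `Γ(Proj S, 𝒪(d))`, the global sections of the `d`-th twisting sheaf `S(d)~` of `Proj S`. -/
def twistSections (d : ℕ) : Submodule k (PointFun 𝒜) where
  carrier := {s | IsLocallyFraction 𝒜 d s}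
  zero_mem' := by
    have h := isLocallyFraction_algebraMap (𝒜 := 𝒜) (d := d) (a := 0) (zero_mem _)
    have e : (fun x => algebraMap S (Localization.AtPrime
      x.asHomogeneousIdeal.toIdeal) 0 : PointFun 𝒜) = 0 := by
      funext x; exact map_zero _
    rw [e] at h
    exact h
  add_mem' := IsLocallyFraction.add
  smul_mem' := fun c _ hs => IsLocallyFraction.smul c hs

end Twist

/-! ### The relative Frobenius of `ℙ^m` and its action on sections -/

section Frobenius

variable (k : Type u) [Field k] (p m : ℕ)

/-- The homogeneous coordinate ring `k[x_0, …, x_m]` of `ℙ^m` with its standard grading. -/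
abbrev coordGrading : ℕ → Submodule k (MvPolynomial (Fin (m + 1)) k) :=
  MvPolynomial.homogeneousSubmodule (Fin (m + 1)) k

instance instGradedCoord : GradedAlgebra (coordGrading k m) := MvPolynomial.gradedAlgebra

/-- The points of `ℙ^m = Proj k[x_0, …, x_m]`, with the Zariski topology. -/
abbrev ProjSpace : Type u := ProjectiveSpectrum (coordGrading k m)

/-- The `k`-algebra endomorphism `x_i ↦ x_i ^ p` of `k[x_0, …, x_m]`. -/
abbrev frobPoly : MvPolynomial (Fin (m + 1)) k →ₐ[k] MvPolynomial (Fin (m + 1)) k :=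
  MvPolynomial.expand p

theorem frobPoly_mem {d : ℕ} {a : MvPolynomial (Fin (m + 1)) k} (ha : a ∈ coordGrading k m d) :
    frobPoly k p m a ∈ coordGrading k m (p * d) := by
  rw [MvPolynomial.mem_homogeneousSubmodule] at ha ⊢
  exact ha.aeval (fun i => MvPolynomial.X i ^ p) (fun i => by
    simpa using (MvPolynomial.isHomogeneous_X k i).pow p)

variable [Fact p.Prime]

/-- The preimage of a homogeneous ideal under `x_i ↦ x_i ^ p`; it is again homogeneous. -/
def frobComap (I : HomogeneousIdeal (coordGrading k m)) : HomogeneousIdeal (coordGrading k m) where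
  toSubmodule := I.toIdeal.comap (frobPoly k p m).toRingHom
  is_homogeneous' := by
    intro i a ha
    have ha' : frobPoly k p m a ∈ I.toIdeal := ha
    change frobPoly k p m _ ∈ I.toIdeal
    have h := I.isHomogeneous (p * i) ha'
    have key : (DirectSum.decompose (coordGrading k m) (frobPoly k p m a) (p * i) :
        MvPolynomial (Fin (m + 1)) k) =
        frobPoly k p m (DirectSum.decompose (coordGrading k m) a i) := by
      clear h ha ha'
      induction a using DirectSum.Decomposition.inductionOn (coordGrading k m) with
      | zero => simp
      | @homogeneous j b =>
        rw [DirectSum.decompose_coe]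
        by_cases hij : j = i
        · subst hij
          rw [DirectSum.of_eq_same]
          exact DirectSum.decompose_of_mem_same _ (frobPoly_mem k p m b.2)
        · rw [DirectSum.of_eq_of_ne _ _ _ (Ne.symm hij)]
          rw [DirectSum.decompose_of_mem_ne _ (frobPoly_mem k p m b.2)]
          · simp
          · intro h
            exact hij (Nat.eq_of_mul_eq_mul_left (Fact.out : p.Prime).pos h)
      | add a b ha hb => simp only [map_add, DirectSum.decompose_add, DirectSum.add_apply,
          Submodule.coe_add, ha, hb]
    rw [key] at h
    exact h

/-- The relative Frobenius endomorphism `f` of `ℙ^m` on points: `x ↦ φ⁻¹(x)`, `φ(x_i) = x_i ^ p`. -/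
def frobPoint (x : ProjSpace k m) : ProjSpace k m where
  asHomogeneousIdeal := frobComap k p m x.asHomogeneousIdeal
  isPrime := Ideal.comap_isPrime _ _
  not_irrelevant_le := by
    intro h
    apply x.not_irrelevant_le
    intro a ha
    have hX : ∀ i, (MvPolynomial.X i : MvPolynomial (Fin (m + 1)) k) ∈
        x.asHomogeneousIdeal.toIdeal := by
      intro i
      have h1 : (MvPolynomial.X i : MvPolynomial (Fin (m + 1)) k) ∈
          HomogeneousIdeal.irrelevant (coordGrading k m) :=
        HomogeneousIdeal.mem_irrelevant_of_mem _ one_pos (MvPolynomial.isHomogeneous_X k i)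
      have h2 : frobPoly k p m (MvPolynomial.X i) ∈ x.asHomogeneousIdeal.toIdeal := h h1
      rw [frobPoly, MvPolynomial.expand_X] at h2
      exact x.isPrime.mem_of_pow_mem p h2
    have h0 : MvPolynomial.coeff 0 a = 0 := by
      rw [HomogeneousIdeal.mem_irrelevant_iff, GradedRing.proj_apply] at ha
      have := MvPolynomial.decomposition.decompose'_apply a 0
      have e : (DirectSum.decompose (coordGrading k m) a 0 : MvPolynomial (Fin (m + 1)) k) =
        MvPolynomial.homogeneousComponent 0 a := this
      rw [e, MvPolynomial.homogeneousComponent_zero] at ha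
      simpa using ha
    have h3 : a ∈ Ideal.span (MvPolynomial.X '' (Set.univ : Set (Fin (m + 1)))) := by
      rw [MvPolynomial.mem_ideal_span_X_image]
      intro d hd
      by_contra! hne
      have hd0 : d = 0 := by
        ext i
        exact hne i trivial
      rw [hd0, MvPolynomial.mem_support_iff] at hd
      exact hd h0
    exact (Ideal.span_le.2 (by rintro _ ⟨i, -, rfl⟩; exact hX i)) h3

theorem continuous_frobPoint : Continuous (frobPoint k p m) := by
  simp_rw [continuous_iff_isClosed, ProjectiveSpectrum.isClosed_iff_zeroLocus, exists_imp,
    forall_eq_apply_imp_iff]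
  refine fun s => ⟨frobPoly k p m '' s, ?_⟩
  ext x
  simp only [Set.mem_preimage, ProjectiveSpectrum.mem_zeroLocus]
  exact (Set.image_subset_iff (f := frobPoly k p m)).symm

theorem frobPoint_toIdeal (x : ProjSpace k m) :
    (frobPoint k p m x).asHomogeneousIdeal.toIdeal =
      x.asHomogeneousIdeal.toIdeal.comap (frobPoly k p m).toRingHom := rfl

/-- The pull-back `s ↦ f^* s`: `(f^* s)(x)` is the image of `s(f x) ∈ S_{f x}` under the map
`S_{f x} → S_x` of local rings induced by `x_i ↦ x_i ^ p`. -/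
def frobPullback : PointFun (coordGrading k m) →ₐ[k] PointFun (coordGrading k m) where
  toFun s x := Localization.localRingHom (frobPoint k p m x).asHomogeneousIdeal.toIdeal
    x.asHomogeneousIdeal.toIdeal (frobPoly k p m).toRingHom (frobPoint_toIdeal k p m x)
    (s (frobPoint k p m x))
  map_one' := by funext x; exact map_one _
  map_mul' s t := by funext x; exact map_mul _ _ _
  map_zero' := by funext x; exact map_zero _
  map_add' s t := by funext x; exact map_add _ _ _
  commutes' c := by
    funext x
    simp only [Pi.algebraMap_apply]
    rw [IsScalarTower.algebraMap_apply k (MvPolynomial (Fin (m + 1)) k) (Localization.AtPrime _),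
      Localization.localRingHom_to_map,
      IsScalarTower.algebraMap_apply k (MvPolynomial (Fin (m + 1)) k) (Localization.AtPrime _)]
    congr 1
    exact (frobPoly k p m).commutes c

/-- `f^*` maps `Γ(𝒪(d))` into `Γ(f^* 𝒪(d)) = Γ(𝒪(p d))`. -/
theorem frobPullback_mem {d : ℕ} {s : PointFun (coordGrading k m)}
    (hs : s ∈ twistSections (coordGrading k m) d) :
    frobPullback k p m s ∈ twistSections (coordGrading k m) (p * d) := by
  intro x
  obtain ⟨U, hU, hxU, i, a, b, ha, hb, H⟩ := hs (frobPoint k p m x)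
  refine ⟨frobPoint k p m ⁻¹' U, hU.preimage (continuous_frobPoint k p m), hxU, p * i,
    frobPoly k p m a, frobPoly k p m b, ?_, frobPoly_mem k p m hb, fun y hy => ?_⟩
  · have := frobPoly_mem k p m ha
    rwa [mul_add] at this
  · obtain ⟨h1, h2⟩ := H _ hy
    refine ⟨h1, ?_⟩
    change Localization.localRingHom _ _ _ (frobPoint_toIdeal k p m y)
      (s (frobPoint k p m y)) = _
    rw [h2, Localization.localRingHom_mk]
    rfl

theorem frobPullback_pow_mem (i : ℕ) {d : ℕ} {s : PointFun (coordGrading k m)}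
    (hs : s ∈ twistSections (coordGrading k m) d) :
    (frobPullback k p m ^ i) s ∈ twistSections (coordGrading k m) (p ^ i * d) := by
  induction i with
  | zero => simpa using hs
  | succ i ih =>
    rw [pow_succ' p, mul_assoc, pow_succ']
    exact frobPullback_mem k p m ih

end Frobenius

/-! ### The twisted homogeneous coordinate ring -/

section TwistedRing

/-- `e_n = 1 + p + ⋯ + p ^ (n - 1)`. -/
def expo (p n : ℕ) : ℕ := ∑ i ∈ Finset.range n, p ^ i

theorem expo_eq_div (p n : ℕ) (hp : 2 ≤ p) : expo p n = (p ^ n - 1) / (p - 1) :=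
  Nat.geomSum_eq hp n

theorem expo_zero (p : ℕ) : expo p 0 = 0 := Finset.sum_range_zero _

theorem expo_one (p : ℕ) : expo p 1 = 1 := by simp [expo]

theorem expo_add (p i j : ℕ) : expo p (i + j) = expo p i + p ^ i * expo p j := by
  simp only [expo, Finset.sum_range_add, Finset.mul_sum, pow_add]

variable (k : Type u) [Field k] (p m : ℕ)

/-- The graded piece `F_n = Γ(ℙ^m, 𝒪(e_n))`. -/
abbrev piece (n : ℕ) : Submodule k (PointFun (coordGrading k m)) :=
  twistSections (coordGrading k m) (expo p n)

theorem algebraMap_mem_piece (c : k) :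
    algebraMap k (PointFun (coordGrading k m)) c ∈ piece k p m 0 := by
  have h := isLocallyFraction_algebraMap (𝒜 := coordGrading k m) (d := expo p 0)
    (a := algebraMap k _ c) (by
      rw [expo_zero]; exact SetLike.algebraMap_mem_graded (coordGrading k m) c)
  exact h

variable [Fact p.Prime]

theorem twistedMul_mem {i j : ℕ} {a c : PointFun (coordGrading k m)} (ha : a ∈ piece k p m i)
    (hc : c ∈ piece k p m j) : a * (frobPullback k p m ^ i) c ∈ piece k p m (i + j) := by
  have h := IsLocallyFraction.mul ha (frobPullback_pow_mem k p m i hc)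
  rw [← expo_add] at h
  exact h

/-- The unit of `F` is the constant section `1 ∈ F_0`. -/
instance instGOne : GradedMonoid.GOne (fun n => piece k p m n) where
  one := ⟨1, by simpa using algebraMap_mem_piece k p m 1⟩

/-- The twisted product `F_i × F_j → F_{i+j}`, `a · c = a f^i(c)`. -/
instance instGMul : GradedMonoid.GMul (fun n => piece k p m n) where
  mul {i _} a c := ⟨a.1 * (frobPullback k p m ^ i) c.1, twistedMul_mem k p m a.2 c.2⟩

instance instGMonoid : GradedMonoid.GMonoid (fun n => piece k p m n) where
  __ := instGOne k p m
  __ := instGMul k p m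
  one_mul := fun ⟨i, a⟩ => Sigma.subtype_ext (zero_add i) (by
    change 1 * (frobPullback k p m ^ 0) a.1 = a.1
    simp)
  mul_one := fun ⟨i, a⟩ => Sigma.subtype_ext (add_zero i) (by
    change a.1 * (frobPullback k p m ^ i) 1 = a.1
    simp)
  mul_assoc := fun ⟨i, a⟩ ⟨j, b⟩ ⟨l, c⟩ => Sigma.subtype_ext (add_assoc i j l) (by
    change a.1 * (frobPullback k p m ^ i) b.1 * (frobPullback k p m ^ (i + j)) c.1 =
      a.1 * (frobPullback k p m ^ i) (b.1 * (frobPullback k p m ^ j) c.1)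
    rw [map_mul, pow_add, AlgHom.mul_apply, mul_assoc])

instance instGRing : DirectSum.GRing (fun n => piece k p m n) where
  __ := instGMonoid k p m
  mul_zero {i j} a := Subtype.ext (by
    change a.1 * (frobPullback k p m ^ i) 0 = 0
    simp)
  zero_mul {i j} b := Subtype.ext (by
    change 0 * (frobPullback k p m ^ i) b.1 = 0
    simp)
  mul_add {i j} a b c := Subtype.ext (by
    change a.1 * (frobPullback k p m ^ i) (b.1 + c.1) =
      a.1 * (frobPullback k p m ^ i) b.1 + a.1 * (frobPullback k p m ^ i) c.1
    rw [map_add, mul_add])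
  add_mul {i j} a b c := Subtype.ext (by
    change (a.1 + b.1) * (frobPullback k p m ^ i) c.1 =
      a.1 * (frobPullback k p m ^ i) c.1 + b.1 * (frobPullback k p m ^ i) c.1
    rw [add_mul])
  natCast n := ⟨algebraMap k _ n, algebraMap_mem_piece k p m n⟩
  natCast_zero := Subtype.ext (by
    change algebraMap k (PointFun (coordGrading k m)) ((0 : ℕ) : k) = 0
    simp)
  natCast_succ n := Subtype.ext (by
    change algebraMap k (PointFun (coordGrading k m)) ((n + 1 : ℕ) : k) =
      algebraMap k (PointFun (coordGrading k m)) (n : k) + 1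
    rw [Nat.cast_succ, map_add, map_one])
  intCast n := ⟨algebraMap k _ n, algebraMap_mem_piece k p m n⟩
  intCast_ofNat n := Subtype.ext (by
    change algebraMap k (PointFun (coordGrading k m)) ((n : ℤ) : k) =
      algebraMap k (PointFun (coordGrading k m)) (n : k)
    rw [Int.cast_natCast])
  intCast_negSucc_ofNat n := Subtype.ext (by
    change algebraMap k (PointFun (coordGrading k m)) ((Int.negSucc n : ℤ) : k) =
      -algebraMap k (PointFun (coordGrading k m)) ((n + 1 : ℕ) : k)
    rw [Int.cast_negSucc, map_neg])

/-- The `k`-algebra structure: a scalar `c` is the constant section `c ∈ F_0`. -/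
instance instGAlgebra : DirectSum.GAlgebra k (fun n => piece k p m n) where
  toFun :=
    { toFun := fun c => ⟨algebraMap k _ c, algebraMap_mem_piece k p m c⟩
      map_zero' := Subtype.ext (map_zero _)
      map_add' := fun _ _ => Subtype.ext (map_add _ _ _) }
  map_one := Subtype.ext (map_one _)
  map_mul r s := Sigma.subtype_ext (add_zero 0).symm (by
    change algebraMap k _ (r * s) =
      algebraMap k _ r * (frobPullback k p m ^ 0) (algebraMap k _ s)
    simp)
  commutes r := fun ⟨i, a⟩ => Sigma.subtype_ext ((zero_add i).trans (add_zero i).symm) (by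
    change algebraMap k _ r * (frobPullback k p m ^ 0) a.1 =
      a.1 * (frobPullback k p m ^ i) (algebraMap k _ r)
    rw [AlgHom.commutes, mul_comm]
    simp)
  smul_def r := fun ⟨i, a⟩ => Sigma.subtype_ext (zero_add i).symm (by
    change r • a.1 = algebraMap k _ r * (frobPullback k p m ^ 0) a.1
    rw [pow_zero, AlgHom.one_apply, Algebra.smul_def])

/-- The twisted homogeneous coordinate ring `F = ⨁ Γ(ℙ^m, 𝒪(e_n))`, `a · c = a f^i(c)` for
`a ∈ F_i`. -/
abbrev TwistedRing : Type u := ⨁ n, piece k p m n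

end TwistedRing

end FrobRing

end

noncomputable section

namespace FrobRing

universe u

section Sections

variable {k : Type u} [Field k] {m : ℕ}

/-- The generic point of `ℙ^m`. -/
def genericPoint (k : Type u) [Field k] (m : ℕ) : ProjSpace k m where
  asHomogeneousIdeal := ⊥
  isPrime := by
    rw [HomogeneousIdeal.toIdeal_bot]
    exact Ideal.isPrime_bot
  not_irrelevant_le := by
    intro h
    have h1 : (MvPolynomial.X 0 : MvPolynomial (Fin (m + 1)) k) ∈
        HomogeneousIdeal.irrelevant (coordGrading k m) :=
      HomogeneousIdeal.mem_irrelevant_of_mem _ one_pos (MvPolynomial.isHomogeneous_X k 0)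
    have h2 := h h1
    rw [← HomogeneousIdeal.mem_iff, HomogeneousIdeal.toIdeal_bot, Ideal.mem_bot] at h2
    exact MvPolynomial.X_ne_zero 0 h2

theorem mem_genericPoint_primeCompl {b : MvPolynomial (Fin (m + 1)) k} :
    b ∈ (genericPoint k m).asHomogeneousIdeal.toIdeal.primeCompl ↔ b ≠ 0 := by
  change b ∉ (⊥ : HomogeneousIdeal (coordGrading k m)).toIdeal ↔ _
  rw [HomogeneousIdeal.toIdeal_bot, Ideal.mem_bot]

theorem genericPoint_mem {U : Set (ProjSpace k m)} (hU : IsOpen U) (hne : U.Nonempty) :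
    genericPoint k m ∈ U := by
  by_contra h
  obtain ⟨s, hs⟩ := (ProjectiveSpectrum.isClosed_iff_zeroLocus _ _).1 hU.isClosed_compl
  have h1 : genericPoint k m ∈ Uᶜ := h
  rw [hs, ProjectiveSpectrum.mem_zeroLocus] at h1
  obtain ⟨x, hx⟩ := hne
  have h2 : x ∈ Uᶜ := by
    rw [hs, ProjectiveSpectrum.mem_zeroLocus]
    intro a ha
    have h3 : a = 0 := by
      by_contra h0
      exact mem_genericPoint_primeCompl.2 h0 (h1 ha)
    rw [h3]
    exact zero_mem x.asHomogeneousIdeal.toIdeal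
  exact h2 hx

theorem algebraMap_injective (x : ProjSpace k m) : Function.Injective
    (algebraMap (MvPolynomial (Fin (m + 1)) k)
      (Localization.AtPrime x.asHomogeneousIdeal.toIdeal)) :=
  IsLocalization.injective _ x.asHomogeneousIdeal.toIdeal.primeCompl_le_nonZeroDivisors

theorem mk_eq_algebraMap {x : ProjSpace k m} {a g b : MvPolynomial (Fin (m + 1)) k}
    {hb : b ∈ x.asHomogeneousIdeal.toIdeal.primeCompl} :
    Localization.mk a ⟨b, hb⟩ =
        algebraMap _ (Localization.AtPrime x.asHomogeneousIdeal.toIdeal) g ↔ g * b = a := by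
  rw [Localization.mk_eq_mk', IsLocalization.mk'_eq_iff_eq_mul, ← map_mul,
    (algebraMap_injective x).eq_iff, eq_comm]

/-- A homogeneous ideal contained in no point of `ℙ^m` contains a power of every coordinate. -/
theorem exists_X_pow_mem {J : Ideal (MvPolynomial (Fin (m + 1)) k)}
    (hJ : J.IsHomogeneous (coordGrading k m))
    (h : ∀ x : ProjSpace k m, ¬ J ≤ x.asHomogeneousIdeal.toIdeal) (i : Fin (m + 1)) :
    ∃ N : ℕ, (MvPolynomial.X i : MvPolynomial (Fin (m + 1)) k) ^ N ∈ J := by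
  change MvPolynomial.X i ∈ J.radical
  rw [Ideal.radical_eq_sInf, Ideal.mem_sInf]
  rintro P ⟨hJP, hP⟩
  by_contra hX
  refine h ⟨P.homogeneousCore (coordGrading k m), hP.homogeneousCore, fun hle => hX ?_⟩ ?_
  · have h1 : (MvPolynomial.X i : MvPolynomial (Fin (m + 1)) k) ∈
        HomogeneousIdeal.irrelevant (coordGrading k m) :=
      HomogeneousIdeal.mem_irrelevant_of_mem _ one_pos (MvPolynomial.isHomogeneous_X k i)
    exact P.toIdeal_homogeneousCore_le _ (hle h1)
  · rw [← hJ.toIdeal_homogeneousCore_eq_self]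
    exact Ideal.homogeneousCore_mono _ hJP

theorem mem_coordGrading_of_mul {d i : ℕ} {g b : MvPolynomial (Fin (m + 1)) k} (hb0 : b ≠ 0)
    (hb : b ∈ coordGrading k m i) (h : g * b ∈ coordGrading k m (d + i)) :
    g ∈ coordGrading k m d := by
  have h1 := DirectSum.coe_decompose_mul_add_of_right_mem (coordGrading k m) (a := g) (i := d) hb
  rw [DirectSum.decompose_of_mem_same _ h] at h1
  rw [mul_right_cancel₀ hb0 h1]
  exact SetLike.coe_mem _

/-- For `m ≥ 1` every global section of `𝒪(d)` on `ℙ^m` is a form of degree `d`. -/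
theorem exists_form_of_mem_twistSections (hm : 1 ≤ m) {d : ℕ}
    {s : PointFun (coordGrading k m)} (hs : s ∈ twistSections (coordGrading k m) d) :
    ∃ g ∈ coordGrading k m d, s = fun _ => algebraMap _ _ g := by
  set S := MvPolynomial (Fin (m + 1)) k
  set η := genericPoint k m
  set φ := algebraMap S (Localization.AtPrime η.asHomogeneousIdeal.toIdeal)
  have hφ : Function.Injective φ := algebraMap_injective η
  set D : Set S := {b | (∃ i, b ∈ coordGrading k m i) ∧ ∃ a, s η * φ b = φ a}
  have local_form : ∀ x : ProjSpace k m, ∃ (i : ℕ) (a b : S)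
      (hb : b ∈ x.asHomogeneousIdeal.toIdeal.primeCompl), a ∈ coordGrading k m (d + i) ∧
      b ∈ coordGrading k m i ∧ s x = Localization.mk a ⟨b, hb⟩ ∧ b ≠ 0 ∧ s η * φ b = φ a := by
    intro x
    obtain ⟨U, hU, hxU, i, a, b, ha, hb, H⟩ := hs x
    obtain ⟨h1, h2⟩ := H x hxU
    obtain ⟨h3, h4⟩ := H η (genericPoint_mem hU ⟨x, hxU⟩)
    refine ⟨i, a, b, h1, ha, hb, h2, mem_genericPoint_primeCompl.1 h3, ?_⟩
    rw [h4, Localization.mk_eq_mk']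
    exact IsLocalization.mk'_spec _ a ⟨b, h3⟩
  have hden : ∀ b ∈ Ideal.span D, ∃ a, s η * φ b = φ a := by
    intro b hb
    induction hb using Submodule.span_induction with
    | mem b hb => exact hb.2
    | zero => exact ⟨0, by simp⟩
    | add b c _ _ hb hc =>
      obtain ⟨a, ha⟩ := hb
      obtain ⟨a', ha'⟩ := hc
      exact ⟨a + a', by rw [map_add, map_add, mul_add, ha, ha']⟩
    | smul r b _ hb =>
      obtain ⟨a, ha⟩ := hb
      exact ⟨r * a, by rw [smul_eq_mul, map_mul, map_mul, ← ha]; ring⟩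
  have hpow : ∀ i, ∃ N : ℕ, (MvPolynomial.X i : S) ^ N ∈ Ideal.span D := by
    refine exists_X_pow_mem (Ideal.homogeneous_span _ _ fun b hb => hb.1) fun x hx => ?_
    obtain ⟨i, a, b, hb, -, hbi, -, -, hab⟩ := local_form x
    exact hb (hx (Ideal.subset_span ⟨⟨i, hbi⟩, a, hab⟩))
  obtain ⟨g, hg⟩ : ∃ g, s η = φ g := by
    obtain ⟨N, hN⟩ := hpow 0
    obtain ⟨M, hM⟩ := hpow (Fin.last m)
    obtain ⟨a, ha⟩ := hden _ hN
    obtain ⟨c, hc⟩ := hden _ hM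
    have h01 : (0 : Fin (m + 1)) ≠ Fin.last m := by
      intro h
      have := congrArg Fin.val h
      simp at this
      omega
    have hac : (MvPolynomial.X (Fin.last m) : S) ^ M * a = MvPolynomial.X 0 ^ N * c := by
      apply hφ
      rw [map_mul, map_mul, ← ha, ← hc]
      ring
    have hX : ¬ (MvPolynomial.X 0 : S) ∣ MvPolynomial.X (Fin.last m) ^ M := by
      intro h
      have := (MvPolynomial.X_prime (R := k) (i := (0 : Fin (m + 1)))).dvd_of_dvd_pow h
      rw [MvPolynomial.X_dvd_X] at this
      exact h01 this
    obtain ⟨g, rfl⟩ := (MvPolynomial.X_prime (R := k)).pow_dvd_of_dvd_mul_left N hX ⟨c, hac⟩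
    refine ⟨g, ?_⟩
    rw [map_mul, mul_comm] at ha
    refine mul_left_cancel₀ (fun h0 => ?_) ha
    rw [map_eq_zero_iff φ hφ] at h0
    exact pow_ne_zero _ (MvPolynomial.X_ne_zero _) h0
  have hgab : ∀ {a b : S}, s η * φ b = φ a → g * b = a := by
    intro a b h
    rw [hg, ← map_mul] at h
    exact hφ h
  refine ⟨g, ?_, ?_⟩
  · obtain ⟨i, a, b, -, ha, hb, -, hb0, hab⟩ := local_form η
    exact mem_coordGrading_of_mul hb0 hb (hgab hab ▸ ha)
  · funext x
    obtain ⟨i, a, b, hb, -, -, hsx, -, hab⟩ := local_form x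
    rw [hsx, mk_eq_algebraMap]
    exact hgab hab

/-- A form of degree `d`, viewed as a global section of `𝒪(d)`. -/
def formSection (k : Type u) [Field k] (m d : ℕ) :
    coordGrading k m d →ₗ[k] twistSections (coordGrading k m) d where
  toFun g := ⟨fun _ => algebraMap _ _ g.1, isLocallyFraction_algebraMap g.2⟩
  map_add' _ _ := Subtype.ext (funext fun _ => map_add _ _ _)
  map_smul' c g := Subtype.ext (funext fun x => by
    exact map_smul (IsScalarTower.toAlgHom k (MvPolynomial (Fin (m + 1)) k)
      (Localization.AtPrime x.asHomogeneousIdeal.toIdeal)) c g.1)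

theorem formSection_bijective (hm : 1 ≤ m) (d : ℕ) :
    Function.Bijective (formSection k m d) := by
  constructor
  · intro a b h
    exact Subtype.ext (algebraMap_injective (genericPoint k m)
      (congrFun (congrArg Subtype.val h) (genericPoint k m)))
  · rintro ⟨s, hs⟩
    obtain ⟨g, hg, rfl⟩ := exists_form_of_mem_twistSections hm hs
    exact ⟨⟨g, hg⟩, rfl⟩

end Sections

/-- Components of a product in a graded ring, read off by additive maps that turn the graded product
into a skew product. -/
theorem apply_directSum_mul {A : ℕ → Type*} [∀ i, AddCommMonoid (A i)] [DirectSum.GSemiring A]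
    {R : Type*} [Semiring R] (φ : ∀ n, A n →+ R) (ψ : ℕ → R →+* R)
    (h : ∀ i j (a : A i) (c : A j),
      φ (i + j) (GradedMonoid.GMul.mul a c) = φ i a * ψ i (φ j c))
    (n : ℕ) (f g : ⨁ n, A n) :
    φ n ((f * g) n) = ∑ ij ∈ Finset.HasAntidiagonal.antidiagonal n,
      φ ij.1 (f ij.1) * ψ ij.1 (φ ij.2 (g ij.2)) := by
  induction f using DirectSum.induction_on with
  | zero => simp
  | add f f' hf hf' =>
    simp only [add_mul, DirectSum.add_apply, map_add, hf, hf', Finset.sum_add_distrib]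
  | of i a =>
    induction g using DirectSum.induction_on with
    | zero => simp
    | add g g' hg hg' =>
      simp only [mul_add, DirectSum.add_apply, map_add, hg, hg', Finset.sum_add_distrib]
    | of j c =>
      rw [DirectSum.of_mul_of]
      by_cases hn : i + j = n
      · subst hn
        rw [DirectSum.of_eq_same, h, Finset.sum_eq_single (i, j)]
        · simp
        · rintro ⟨i', j'⟩ - hne
          by_cases hi : i' = i
          · have hj : j' ≠ j := fun hj => hne (by rw [hi, hj])
            simp [DirectSum.of_eq_of_ne _ _ _ hj]
          · simp [DirectSum.of_eq_of_ne _ _ _ hi]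
        · exact fun hn => (hn (Finset.HasAntidiagonal.mem_antidiagonal.2 rfl)).elim
      · rw [DirectSum.of_eq_of_ne _ _ _ (Ne.symm hn), map_zero]
        refine (Finset.sum_eq_zero ?_).symm
        rintro ⟨i', j'⟩ hij
        rw [Finset.HasAntidiagonal.mem_antidiagonal] at hij
        by_cases hi : i' = i
        · have hj : j' ≠ j := fun hj => hn (by rw [← hi, ← hj]; exact hij)
          simp [DirectSum.of_eq_of_ne _ _ _ hj]
        · simp [DirectSum.of_eq_of_ne _ _ _ hi]

theorem degree_eq_of_coeff_ne_zero {k : Type*} [Field k] {m d : ℕ}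
    {g : MvPolynomial (Fin (m + 1)) k} (hg : g ∈ coordGrading k m d) {δ : Fin (m + 1) →₀ ℕ}
    (h : g.coeff δ ≠ 0) : δ.degree = d := by
  have := hg h
  rw [Finsupp.degree_eq_weight_one]
  exact this

/-- An identification of the graded ring `⨁ A n` with the forms of degrees `e_n` in `m + 1`
variables, multiplied by `a · c = a (c(x_0 ^ (p ^ i), …, x_m ^ (p ^ i)))` for `a` in degree `i`. -/
structure FormPresentation (k : Type*) [Field k] (p m : ℕ) (A : ℕ → Type*)
    [∀ n, AddCommMonoid (A n)] [∀ n, Module k (A n)] [DirectSum.GSemiring A] where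
  /-- The form of an element of `A n`. -/
  equiv : ∀ n, A n ≃ₗ[k] coordGrading k m (expo p n)
  map_one : (equiv 0 GradedMonoid.GOne.one : MvPolynomial (Fin (m + 1)) k) = 1
  map_mul : ∀ i j (a : A i) (c : A j),
    (equiv (i + j) (GradedMonoid.GMul.mul a c) : MvPolynomial (Fin (m + 1)) k) =
      equiv i a * MvPolynomial.expand (p ^ i) (equiv j c).1

namespace FormPresentation

variable {k : Type*} [Field k] {p m : ℕ} {A : ℕ → Type*} [∀ n, AddCommMonoid (A n)]
  [∀ n, Module k (A n)] [DirectSum.GSemiring A] (P : FormPresentation k p m A)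

/-- The form of degree `e_n` corresponding to the component of degree `n`. -/
def form (n : ℕ) : (⨁ n, A n) →ₗ[k] MvPolynomial (Fin (m + 1)) k :=
  (coordGrading k m (expo p n)).subtype ∘ₗ (P.equiv n).toLinearMap ∘ₗ DirectSum.component k ℕ A n

theorem form_apply (n : ℕ) (f : ⨁ n, A n) : P.form n f = P.equiv n (f n) := rfl

theorem form_mem (n : ℕ) (f : ⨁ n, A n) : P.form n f ∈ coordGrading k m (expo p n) :=
  SetLike.coe_mem _

/-- The element of degree `n` given by a form of degree `e_n`. -/
def ofForm (n : ℕ) (g : coordGrading k m (expo p n)) : ⨁ n, A n :=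
  DirectSum.of A n ((P.equiv n).symm g)

theorem form_ofForm_self (n : ℕ) (g : coordGrading k m (expo p n)) :
    P.form n (P.ofForm n g) = g.1 := by
  rw [form_apply, ofForm, DirectSum.of_eq_same, LinearEquiv.apply_symm_apply]

theorem form_of_of_ne {n l : ℕ} (h : l ≠ n) (a : A n) : P.form l (DirectSum.of A n a) = 0 := by
  rw [form_apply, DirectSum.of_eq_of_ne _ _ _ h, _root_.map_zero]
  rfl

theorem form_mul (n : ℕ) (f g : ⨁ n, A n) :
    P.form n (f * g) = ∑ ij ∈ Finset.HasAntidiagonal.antidiagonal n,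
      P.form ij.1 f * MvPolynomial.expand (p ^ ij.1) (P.form ij.2 g) :=
  apply_directSum_mul
    (fun n => ((coordGrading k m (expo p n)).subtype ∘ₗ (P.equiv n).toLinearMap).toAddMonoidHom)
    (fun i => (MvPolynomial.expand (p ^ i)).toRingHom) P.map_mul n f g

theorem mul_expand_mem {i j : ℕ} {a c : MvPolynomial (Fin (m + 1)) k}
    (ha : a ∈ coordGrading k m (expo p i)) (hc : c ∈ coordGrading k m (expo p j)) :
    a * MvPolynomial.expand (p ^ i) c ∈ coordGrading k m (expo p (i + j)) := by
  rw [expo_add]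
  exact SetLike.mul_mem_graded ha (frobPoly_mem k (p ^ i) m hc)

theorem ofForm_mul {i j : ℕ} (a : coordGrading k m (expo p i)) (c : coordGrading k m (expo p j)) :
    P.ofForm i a * P.ofForm j c = P.ofForm (i + j) ⟨a.1 * MvPolynomial.expand (p ^ i) c.1,
      mul_expand_mem a.2 c.2⟩ := by
  rw [ofForm, ofForm, ofForm, DirectSum.of_mul_of]
  congr 1
  rw [LinearEquiv.eq_symm_apply]
  refine Subtype.ext ?_
  rw [P.map_mul, LinearEquiv.apply_symm_apply, LinearEquiv.apply_symm_apply]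

theorem form_algebraMap [DirectSum.GAlgebra k A] {n : ℕ} (hn : n ≠ 0) (c : k) :
    P.form n (algebraMap k (⨁ n, A n) c) = 0 := by
  rw [DirectSum.algebraMap_apply]
  exact P.form_of_of_ne hn _

/-- A coefficient of `f * g` vanishes if in each way of writing its exponent as `γ + p ^ i β`
the coefficient of `f` at `γ` or the one of `g` at `β` vanishes. -/
theorem coeff_form_mul_eq_zero (hp : p ≠ 0) (n : ℕ) (δ : Fin (m + 1) →₀ ℕ) (f g : ⨁ n, A n)
    (h : ∀ i j γ β, i + j = n → γ + p ^ i • β = δ → γ.degree = expo p i → β.degree = expo p j →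
      (P.form i f).coeff γ = 0 ∨ (P.form j g).coeff β = 0) :
    (P.form n (f * g)).coeff δ = 0 := by
  rw [form_mul, MvPolynomial.coeff_sum]
  refine Finset.sum_eq_zero ?_
  rintro ⟨i, j⟩ hij
  rw [Finset.HasAntidiagonal.mem_antidiagonal] at hij
  rw [MvPolynomial.coeff_mul]
  refine Finset.sum_eq_zero ?_
  rintro ⟨γ, ε⟩ hγε
  rw [Finset.HasAntidiagonal.mem_antidiagonal] at hγε
  by_contra hne
  have h1 := left_ne_zero_of_mul hne
  have h2 := right_ne_zero_of_mul hne
  obtain ⟨β, rfl⟩ : ∃ β, ε = p ^ i • β := by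
    refine ⟨ε.mapRange (· / p ^ i) (Nat.zero_div _), ?_⟩
    ext l
    have hd : p ^ i ∣ ε l := by
      by_contra hnd
      exact h2 (MvPolynomial.coeff_expand_of_not_dvd _ hnd)
    simp [Nat.mul_div_cancel' hd]
  dsimp only at h2
  rw [MvPolynomial.coeff_expand_smul _ (pow_ne_zero i hp)] at h2
  exact (h i j γ β hij hγε (degree_eq_of_coeff_ne_zero (P.form_mem _ _) h1)
    (degree_eq_of_coeff_ne_zero (P.form_mem _ _) h2)).elim h1 h2

end FormPresentation

section Presentation

variable {k : Type u} [Field k] {p m : ℕ} [Fact p.Prime]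

theorem frobPullback_pow_algebraMap (i : ℕ) (g : MvPolynomial (Fin (m + 1)) k) :
    (frobPullback k p m ^ i) (fun _ => algebraMap _ _ g) =
      fun _ => algebraMap _ _ (MvPolynomial.expand (p ^ i) g) := by
  induction i with
  | zero => simp
  | succ i ih =>
    rw [pow_succ', AlgHom.mul_apply, ih]
    funext x
    refine (Localization.localRingHom_to_map _ _ _ (frobPoint_toIdeal k p m x) _).trans ?_
    rw [pow_succ', MvPolynomial.expand_mul]
    rfl

/-- For `m ≥ 1`, the twisted homogeneous coordinate ring is a ring of forms. -/
def twistedRingPresentation (k : Type u) [Field k] (p m : ℕ) [Fact p.Prime] (hm : 1 ≤ m) :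
    FormPresentation k p m (fun n => piece k p m n) where
  equiv n := (LinearEquiv.ofBijective _ (formSection_bijective hm (expo p n))).symm
  map_one := by
    have h : (GradedMonoid.GOne.one (A := fun n => piece k p m n) : piece k p m 0) =
        formSection k m _ ⟨1, by
        rw [expo_zero]; exact SetLike.one_mem_graded (coordGrading k m)⟩ := by
      refine Subtype.ext (funext fun x => ?_)
      exact (algebraMap (MvPolynomial (Fin (m + 1)) k)
        (Localization.AtPrime x.asHomogeneousIdeal.toIdeal)).map_one.symm
    rw [h]
    exact congrArg Subtype.val
      ((LinearEquiv.ofBijective _ (formSection_bijective hm (expo p 0))).symm_apply_apply _)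
  map_mul i j a c := by
    obtain ⟨a, rfl⟩ := (formSection_bijective hm (expo p i)).2 a
    obtain ⟨c, rfl⟩ := (formSection_bijective hm (expo p j)).2 c
    have h : (GradedMonoid.GMul.mul (A := fun n => piece k p m n) (formSection k m _ a)
        (formSection k m _ c) : piece k p m (i + j)) = formSection k m _
          ⟨a.1 * MvPolynomial.expand (p ^ i) c.1, FormPresentation.mul_expand_mem a.2 c.2⟩ := by
      refine Subtype.ext ?_
      change (fun _ => algebraMap _ _ a.1) *
        (frobPullback k p m ^ i) (fun _ => algebraMap _ _ c.1) = _
      rw [frobPullback_pow_algebraMap]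
      funext x
      exact ((algebraMap (MvPolynomial (Fin (m + 1)) k)
        (Localization.AtPrime x.asHomogeneousIdeal.toIdeal)).map_mul _ _).symm
    have hsymm : ∀ (n : ℕ) (g : coordGrading k m (expo p n)),
        ((LinearEquiv.ofBijective _ (formSection_bijective hm (expo p n))).symm
          (formSection k m _ g)).1 = g.1 := fun n g => congrArg Subtype.val
      ((LinearEquiv.ofBijective _ (formSection_bijective hm (expo p n))).symm_apply_apply g)
    rw [h, hsymm, hsymm, hsymm]

end Presentation

theorem expo_succ (p n : ℕ) : expo p (n + 1) = expo p n + p ^ n :=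
  Finset.sum_range_succ _ _

theorem expo_succ' (p n : ℕ) : expo p (n + 1) = 1 + p * expo p n := by
  rw [add_comm, expo_add, expo_one, pow_one]

theorem expo_lt_pow {p : ℕ} (hp : 2 ≤ p) (n : ℕ) : expo p n < p ^ n := by
  induction n with
  | zero => simp [expo_zero]
  | succ n ih =>
    rw [expo_succ, pow_succ]
    nlinarith

theorem apply_le_degree {m : ℕ} (γ : Fin (m + 1) →₀ ℕ) (i : Fin (m + 1)) : γ i ≤ γ.degree := by
  rw [Finsupp.degree_eq_sum]
  exact Finset.single_le_sum (f := fun i => γ i) (fun _ _ => Nat.zero_le _) (Finset.mem_univ i)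

theorem apply_add_apply_le_degree {m : ℕ} (γ : Fin (m + 1) →₀ ℕ) {i j : Fin (m + 1)} (h : i ≠ j) :
    γ i + γ j ≤ γ.degree := by
  rw [Finsupp.degree_eq_sum, ← Finset.sum_pair h]
  exact Finset.sum_le_sum_of_subset (Finset.subset_univ _)

/-- An exponent of degree `e_n` congruent to `-1` modulo `p ^ (n - 1)` in one coordinate, and not
divisible by `p` in another, does not decompose. -/
theorem add_pow_smul_ne {p m n i : ℕ} (hp : 2 ≤ p) {s t : Fin (m + 1)} (hst : s ≠ t)
    {α γ β : Fin (m + 1) →₀ ℕ} (hs : α s + 1 = p ^ n) (ht : ¬ p ∣ α t) (hi : 1 ≤ i) (hin : i ≤ n)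
    (hγ : γ.degree = expo p i) : γ + p ^ i • β ≠ α := by
  rintro rfl
  simp only [Finsupp.add_apply, Finsupp.smul_apply, smul_eq_mul] at hs ht
  have h1 : p ^ i ∣ γ s + 1 := by
    have h2 : p ^ i ∣ γ s + 1 + p ^ i * β s := by
      rw [show γ s + 1 + p ^ i * β s = p ^ n by omega]
      exact pow_dvd_pow p hin
    exact (Nat.dvd_add_left (dvd_mul_right _ _)).1 h2
  have h3 := Nat.le_of_dvd (Nat.succ_pos _) h1
  have h4 : γ t ≠ 0 := by
    intro h0
    rw [h0, zero_add] at ht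
    exact ht ((dvd_pow_self p (by omega)).mul_right _)
  have h5 := apply_add_apply_le_degree γ hst
  have h6 := expo_lt_pow hp i
  omega

namespace FormPresentation

variable {k : Type*} [Field k] {p m : ℕ} {A : ℕ → Type*} [∀ n, AddCommMonoid (A n)]
  [∀ n, Module k (A n)] [DirectSum.GSemiring A] (P : FormPresentation k p m A)

section NotFiniteType

variable [DirectSum.GAlgebra k A]

/-- The elements whose coefficients at the indecomposable exponents `α n` vanish for `n > N`. -/
def vanishingSubalgebra (hp : p ≠ 0) (α : ℕ → Fin (m + 1) →₀ ℕ)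
    (hα : ∀ n i γ β, 1 ≤ i → i < n → γ.degree = expo p i → γ + p ^ i • β ≠ α n) (N : ℕ) :
    Subalgebra k (⨁ n, A n) where
  carrier := {f | ∀ n, N < n → (P.form n f).coeff (α n) = 0}
  algebraMap_mem' c n hn := by
    rw [P.form_algebraMap (by omega), MvPolynomial.coeff_zero]
  add_mem' {f g} hf hg n hn := by
    rw [map_add, MvPolynomial.coeff_add, hf n hn, hg n hn, add_zero]
  mul_mem' {f g} hf hg n hn := by
    refine P.coeff_form_mul_eq_zero hp n _ f g fun i j γ β hij hδ hγ hβ => ?_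
    rcases Nat.eq_zero_or_pos i with rfl | hi
    · right
      rw [expo_zero, Finsupp.degree_eq_zero_iff] at hγ
      rw [hγ, pow_zero, one_smul, zero_add] at hδ
      rw [zero_add] at hij
      rw [hδ, hij]
      exact hg n hn
    rcases Nat.eq_zero_or_pos j with rfl | hj
    · left
      rw [expo_zero, Finsupp.degree_eq_zero_iff] at hβ
      rw [hβ, smul_zero, add_zero] at hδ
      rw [add_zero] at hij
      rw [hδ, hij]
      exact hf n hn
    · exact absurd hδ (hα n i γ β hi (by omega) hγ)

theorem not_finiteType_of_indecomposable (P : FormPresentation k p m A) (hp : p ≠ 0)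
    (α : ℕ → Fin (m + 1) →₀ ℕ)
    (hdeg : ∀ n, 2 ≤ n → (α n).degree = expo p n)
    (hα : ∀ n i γ β, 1 ≤ i → i < n → γ.degree = expo p i → γ + p ^ i • β ≠ α n) :
    ¬ Algebra.FiniteType k (⨁ n, A n) := by
  classical
  rintro ⟨T, hT⟩
  set N := T.sup fun f => f.support.sup id
  have hle : Algebra.adjoin k (T : Set (⨁ n, A n)) ≤ P.vanishingSubalgebra hp α hα (N + 1) := by
    refine Algebra.adjoin_le fun f hf n hn => ?_
    have hfn : f n = 0 := by
      by_contra h0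
      have h1 : n ≤ f.support.sup id := Finset.le_sup (f := id) (DFinsupp.mem_support_iff.2 h0)
      have h2 : f.support.sup id ≤ N := Finset.le_sup (f := fun f => f.support.sup id) hf
      omega
    rw [P.form_apply, hfn, _root_.map_zero]
    rfl
  rw [hT] at hle
  have hmem : MvPolynomial.monomial (α (N + 2)) (1 : k) ∈ coordGrading k m (expo p (N + 2)) :=
    MvPolynomial.isHomogeneous_monomial _ (hdeg _ (by omega))
  have h : P.ofForm (N + 2) ⟨_, hmem⟩ ∈ (⊤ : Subalgebra k (⨁ n, A n)) := Algebra.mem_top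
  have h2 := hle h (N + 2) (by omega)
  rw [P.form_ofForm_self, MvPolynomial.coeff_monomial, if_pos rfl] at h2
  exact one_ne_zero h2

theorem not_finiteType (P : FormPresentation k p m A) (hp : p.Prime) (hm : 1 ≤ m)
    (h : ¬ (p = 2 ∧ m = 1)) :
    ¬ Algebra.FiniteType k (⨁ n, A n) := by
  have hp2 := hp.two_le
  have h1 : 1 % (m + 1) = 1 := Nat.mod_eq_of_lt (by omega)
  have h01 : (0 : Fin (m + 1)) ≠ 1 := by
    intro h
    have := congrArg Fin.val h
    simp [h1] at this
  obtain ⟨α, hα⟩ : ∃ α : ℕ → Fin (m + 1) →₀ ℕ, ∀ n,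
      (α (n + 2)).degree = expo p (n + 2) ∧ α (n + 2) 0 + 1 = p ^ (n + 1) ∧
        ¬ p ∣ α (n + 2) 1 := by
    have hpos : ∀ n, 0 < p ^ n := fun n => Nat.pow_pos (by omega)
    by_cases hm1 : m = 1
    · have hp3 : 3 ≤ p := by
        rcases Nat.lt_or_ge 2 p with h2 | h2
        · exact h2
        · exact absurd ⟨le_antisymm h2 hp2, hm1⟩ h
      refine ⟨fun n => Finsupp.single 0 (p ^ (n - 1) - 1) +
        Finsupp.single 1 (expo p (n - 1) + 1), fun n => ?_⟩
      have := hpos (n + 1)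
      refine ⟨?_, ?_, ?_⟩
      · rw [map_add, Finsupp.degree_single, Finsupp.degree_single, expo_succ p (n + 1)]
        simp only [Nat.add_succ_sub_one]
        omega
      · simp only [Nat.add_succ_sub_one, Finsupp.add_apply, Finsupp.single_eq_same,
          Finsupp.single_eq_of_ne h01]
        omega
      · simp only [Nat.add_succ_sub_one, Finsupp.add_apply, Finsupp.single_eq_same,
          Finsupp.single_eq_of_ne h01.symm, expo_succ']
        intro hd
        rw [show 0 + (1 + p * expo p n + 1) = 2 + p * expo p n by ring,
          Nat.dvd_add_left (dvd_mul_right _ _)] at hd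
        have := Nat.le_of_dvd (by norm_num) hd
        omega
    · have h02 : (0 : Fin (m + 1)) ≠ Fin.last m := by
        intro h
        have := congrArg Fin.val h
        simp at this
        omega
      have h12 : (1 : Fin (m + 1)) ≠ Fin.last m := by
        intro h
        have := congrArg Fin.val h
        simp [h1] at this
        omega
      refine ⟨fun n => Finsupp.single 0 (p ^ (n - 1) - 1) + Finsupp.single 1 1 +
        Finsupp.single (Fin.last m) (expo p (n - 1)), fun n => ?_⟩
      have := hpos (n + 1)
      refine ⟨?_, ?_, ?_⟩
      · rw [map_add, map_add, Finsupp.degree_single, Finsupp.degree_single, Finsupp.degree_single,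
          expo_succ p (n + 1)]
        simp only [Nat.add_succ_sub_one]
        omega
      · simp only [Nat.add_succ_sub_one, Finsupp.add_apply, Finsupp.single_eq_same,
          Finsupp.single_eq_of_ne h01, Finsupp.single_eq_of_ne h02]
        omega
      · simp only [Nat.add_succ_sub_one, Finsupp.add_apply, Finsupp.single_eq_same,
          Finsupp.single_eq_of_ne h01.symm, Finsupp.single_eq_of_ne h12]
        intro hd
        have := Nat.le_of_dvd (by norm_num) hd
        omega
  refine P.not_finiteType_of_indecomposable hp.ne_zero α (fun n hn => ?_)
    fun n i γ β hi hin hγ => ?_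
  · obtain ⟨n, rfl⟩ := Nat.exists_eq_add_of_le' hn
    exact (hα n).1
  · obtain ⟨n, rfl⟩ := Nat.exists_eq_add_of_le' (show 2 ≤ n by omega)
    exact add_pow_smul_ne hp2 h01 (hα n).2.1 (hα n).2.2 hi (by omega) hγ

end NotFiniteType

section Noetherian

/-- In terms of the monomials `u = x_0` and `v = x_m` of degree `1`, the left ideal of the elements
without terms `v ^ n`, and without terms `u v ^ n` for `n ≥ N`. -/
def leftChain (hp : 2 ≤ p) (N : ℕ) : Submodule (⨁ n, A n) (⨁ n, A n) where
  carrier := {f | ∀ n δ, (δ 0 = 0 → (P.form n f).coeff δ = 0) ∧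
    (δ 0 = 1 → N < n → (P.form n f).coeff δ = 0)}
  zero_mem' n δ := by simp
  add_mem' {f g} hf hg n δ := by
    constructor
    · intro h
      rw [map_add, MvPolynomial.coeff_add, (hf n δ).1 h, (hg n δ).1 h, add_zero]
    · intro h hn
      rw [map_add, MvPolynomial.coeff_add, (hf n δ).2 h hn, (hg n δ).2 h hn, add_zero]
  smul_mem' f g hg n δ := by
    have hpos : ∀ i, 0 < p ^ i := fun i => Nat.pow_pos (by omega)
    rw [smul_eq_mul]
    constructor
    · intro h
      refine P.coeff_form_mul_eq_zero (by omega) n δ f g fun i j γ β hij hδ _ _ => Or.inr ?_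
      rw [← hδ] at h
      simp only [Finsupp.add_apply, Finsupp.smul_apply, smul_eq_mul, add_eq_zero,
        mul_eq_zero, (hpos i).ne', false_or] at h
      exact (hg j β).1 h.2
    · intro h hn
      refine P.coeff_form_mul_eq_zero (by omega) n δ f g fun i j γ β hij hδ _ _ => Or.inr ?_
      rw [← hδ] at h
      simp only [Finsupp.add_apply, Finsupp.smul_apply, smul_eq_mul] at h
      rcases Nat.eq_zero_or_pos (β 0) with h0 | h0
      · exact (hg j β).1 h0
      rcases Nat.eq_zero_or_pos i with rfl | hi
      · rw [pow_zero, one_mul] at h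
        exact (hg j β).2 (by omega) (by omega)
      · have h1 : 2 ≤ p ^ i := hp.trans (Nat.le_self_pow (by omega) p)
        have h2 : p ^ i ≤ p ^ i * β 0 := Nat.le_mul_of_pos_right _ h0
        omega

/-- The right ideal of the elements without terms `v ^ n`, and without terms `v ^ n u` for
`n ≥ N`, where `u = x_0` and `v = x_m`. -/
def rightChain (hp : 2 ≤ p) (N : ℕ) : Submodule (⨁ n, A n)ᵐᵒᵖ (⨁ n, A n)ᵐᵒᵖ where
  carrier := {f | (∀ n δ, δ 0 = 0 → (P.form n f.unop).coeff δ = 0) ∧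
    ∀ n δ, δ 0 = p ^ n → N ≤ n → (P.form (n + 1) f.unop).coeff δ = 0}
  zero_mem' := by simp
  add_mem' {f g} hf hg := by
    constructor
    · intro n δ h
      rw [MulOpposite.unop_add, map_add, MvPolynomial.coeff_add, hf.1 n δ h, hg.1 n δ h, add_zero]
    · intro n δ h hn
      rw [MulOpposite.unop_add, map_add, MvPolynomial.coeff_add, hf.2 n δ h hn, hg.2 n δ h hn,
        add_zero]
  smul_mem' g f hf := by
    rw [smul_eq_mul]
    constructor
    · intro n δ h
      rw [MulOpposite.unop_mul]
      refine P.coeff_form_mul_eq_zero (by omega) n δ _ _ fun i j γ β hij hδ _ _ => Or.inl ?_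
      rw [← hδ] at h
      simp only [Finsupp.add_apply, add_eq_zero] at h
      exact hf.1 i γ h.1
    · intro n δ h hn
      rw [MulOpposite.unop_mul]
      refine P.coeff_form_mul_eq_zero (by omega) _ δ _ _ fun i j γ β hij hδ hγ _ => Or.inl ?_
      rw [← hδ] at h
      simp only [Finsupp.add_apply, Finsupp.smul_apply, smul_eq_mul] at h
      have h1 := (apply_le_degree γ 0).trans_lt (hγ.trans_lt (expo_lt_pow hp i))
      rcases Nat.lt_or_ge n i with hi | hi
      · obtain rfl : i = n + 1 := by omega
        refine hf.2 n γ ?_ hn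
        rcases Nat.eq_zero_or_pos (β 0) with h0 | h0
        · rw [h0, mul_zero, add_zero] at h
          exact h
        · have h2 : p ^ (n + 1) ≤ p ^ (n + 1) * β 0 := Nat.le_mul_of_pos_right _ h0
          have h3 : p ^ n < p ^ (n + 1) := Nat.pow_lt_pow_right (by omega) (by omega)
          omega
      · refine hf.1 i γ (Nat.eq_zero_of_dvd_of_lt ?_ h1)
        refine (Nat.dvd_add_left (dvd_mul_right (p ^ i) (β 0))).1 ?_
        rw [h]
        exact pow_dvd_pow p hi

theorem not_isNoetherianRing (P : FormPresentation k p m A) (hp : 2 ≤ p) (hm : 1 ≤ m) :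
    ¬ IsNoetherianRing (⨁ n, A n) := by
  intro hN
  have hmono : Monotone (P.leftChain hp) := fun N M hNM f hf n δ =>
    ⟨(hf n δ).1, fun h hn => (hf n δ).2 h (by omega)⟩
  obtain ⟨N, hstab⟩ := monotone_stabilizes_iff_noetherian.2 hN ⟨P.leftChain hp, hmono⟩
  have h0 : (0 : Fin (m + 1)) ≠ Fin.last m := by
    intro h
    have := congrArg Fin.val h
    simp at this
    omega
  set δ₀ : Fin (m + 1) →₀ ℕ :=
    Finsupp.single 0 1 + Finsupp.single (Fin.last m) (expo p (N + 1) - 1)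
  have hδ₀ : δ₀ 0 = 1 := by
    simp only [δ₀, Finsupp.add_apply, Finsupp.single_eq_same, Finsupp.single_eq_of_ne h0, add_zero]
  have hmem : MvPolynomial.monomial δ₀ (1 : k) ∈ coordGrading k m (expo p (N + 1)) := by
    refine MvPolynomial.isHomogeneous_monomial _ ?_
    rw [map_add, Finsupp.degree_single, Finsupp.degree_single, expo_succ']
    omega
  have h1 : P.ofForm (N + 1) ⟨_, hmem⟩ ∈ P.leftChain hp (N + 1) := by
    intro n δ
    constructor
    · intro h
      by_cases hn : n = N + 1
      · subst hn
        rw [P.form_ofForm_self, MvPolynomial.coeff_monomial, if_neg]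
        rintro rfl
        omega
      · rw [ofForm, P.form_of_of_ne hn, MvPolynomial.coeff_zero]
    · intro h hn
      rw [ofForm, P.form_of_of_ne hn.ne', MvPolynomial.coeff_zero]
  have h2 : P.leftChain hp N = P.leftChain hp (N + 1) := hstab (N + 1) (by omega)
  rw [← h2] at h1
  have h3 := (h1 (N + 1) δ₀).2 hδ₀ (by omega)
  rw [P.form_ofForm_self, MvPolynomial.coeff_monomial, if_pos rfl] at h3
  exact one_ne_zero h3

theorem not_isNoetherianRing_op (P : FormPresentation k p m A) (hp : 2 ≤ p) (hm : 1 ≤ m) :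
    ¬ IsNoetherianRing (⨁ n, A n)ᵐᵒᵖ := by
  intro hN
  have hmono : Monotone (P.rightChain hp) := fun N M hNM f hf =>
    ⟨hf.1, fun n δ h hn => hf.2 n δ h (hNM.trans hn)⟩
  obtain ⟨N, hstab⟩ := monotone_stabilizes_iff_noetherian.2 hN ⟨P.rightChain hp, hmono⟩
  have hpos : ∀ i, 0 < p ^ i := fun i => Nat.pow_pos (by omega)
  have h0 : (0 : Fin (m + 1)) ≠ Fin.last m := by
    intro h
    have := congrArg Fin.val h
    simp at this
    omega
  set δ₀ : Fin (m + 1) →₀ ℕ :=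
    Finsupp.single 0 (p ^ N) + Finsupp.single (Fin.last m) (expo p N)
  have hδ₀ : δ₀ 0 = p ^ N := by
    simp only [δ₀, Finsupp.add_apply, Finsupp.single_eq_same, Finsupp.single_eq_of_ne h0, add_zero]
  have hmem : MvPolynomial.monomial δ₀ (1 : k) ∈ coordGrading k m (expo p (N + 1)) := by
    refine MvPolynomial.isHomogeneous_monomial _ ?_
    rw [map_add, Finsupp.degree_single, Finsupp.degree_single, expo_succ, add_comm]
  have h1 : MulOpposite.op (P.ofForm (N + 1) ⟨_, hmem⟩) ∈ P.rightChain hp (N + 1) := by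
    constructor
    · intro n δ h
      rw [MulOpposite.unop_op]
      by_cases hn : n = N + 1
      · subst hn
        rw [P.form_ofForm_self, MvPolynomial.coeff_monomial, if_neg]
        rintro rfl
        exact (hpos N).ne' (hδ₀.symm.trans h)
      · rw [ofForm, P.form_of_of_ne hn, MvPolynomial.coeff_zero]
    · intro n δ h hn
      rw [MulOpposite.unop_op, ofForm, P.form_of_of_ne (by omega), MvPolynomial.coeff_zero]
  have h2 : P.rightChain hp N = P.rightChain hp (N + 1) := hstab (N + 1) (by omega)
  rw [← h2] at h1
  have h3 := h1.2 N δ₀ hδ₀ le_rfl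
  rw [MulOpposite.unop_op, P.form_ofForm_self, MvPolynomial.coeff_monomial, if_pos rfl] at h3
  exact one_ne_zero h3

end Noetherian

section Generation

theorem ofForm_congr {n l : ℕ} (h : n = l) (g : coordGrading k m (expo p n))
    (g' : coordGrading k m (expo p l)) (hg : g.1 = g'.1) : P.ofForm n g = P.ofForm l g' := by
  subst h
  rw [Subtype.ext hg]

theorem ofForm_zero_C [DirectSum.GAlgebra k A] (c : k)
    (h : MvPolynomial.C c ∈ coordGrading k m (expo p 0)) :
    P.ofForm 0 ⟨MvPolynomial.C c, h⟩ = algebraMap k (⨁ n, A n) c := by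
  rw [Algebra.algebraMap_eq_smul_one, DirectSum.one_def, ofForm, ← DirectSum.lof_eq_of k,
    ← DirectSum.lof_eq_of k, ← map_smul]
  congr 1
  rw [LinearEquiv.symm_apply_eq, map_smul]
  refine Subtype.ext ?_
  rw [Submodule.coe_smul, P.map_one]
  exact MvPolynomial.C_eq_smul_one

theorem exists_eq_single_add_two_smul {n : ℕ} {δ : Fin (1 + 1) →₀ ℕ}
    (hδ : δ.degree = expo 2 (n + 1)) :
    ∃ i ε, ε.degree = expo 2 n ∧ δ = Finsupp.single i 1 + 2 • ε := by
  rw [Finsupp.degree_eq_sum, Fin.sum_univ_two, expo_succ'] at hδ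
  set ε : Fin (1 + 1) →₀ ℕ := δ.mapRange (· / 2) (Nat.zero_div _)
  have hε : ∀ i, ε i = δ i / 2 := fun i => Finsupp.mapRange_apply
  rcases Nat.mod_two_eq_zero_or_one (δ 0) with h | h
  · refine ⟨1, ε, ?_, ?_⟩
    · rw [Finsupp.degree_eq_sum, Fin.sum_univ_two, hε, hε]
      omega
    · ext i
      fin_cases i
      · simp [hε]
        omega
      · simp [hε]
        omega
  · refine ⟨0, ε, ?_, ?_⟩
    · rw [Finsupp.degree_eq_sum, Fin.sum_univ_two, hε, hε]
      omega
    · ext i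
      fin_cases i
      · simp [hε]
        omega
      · simp [hε]
        omega

theorem monomial_mem {n : ℕ} {δ : Fin (m + 1) →₀ ℕ} (hδ : δ.degree = expo p n) (c : k) :
    MvPolynomial.monomial δ c ∈ coordGrading k m (expo p n) :=
  MvPolynomial.isHomogeneous_monomial _ hδ

theorem adjoin_degree_one_eq_top [DirectSum.GAlgebra k A] (P : FormPresentation k 2 1 A) :
    Algebra.adjoin k (Set.range (DirectSum.lof k ℕ A 1)) = ⊤ := by
  set B := Algebra.adjoin k (Set.range (DirectSum.lof k ℕ A 1))
  have hone : ∀ g, P.ofForm 1 g ∈ B := fun g => Algebra.subset_adjoin ⟨_, rfl⟩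
  have hmon : ∀ n (δ : Fin (1 + 1) →₀ ℕ) (hδ : δ.degree = expo 2 n) (c : k),
      P.ofForm n ⟨MvPolynomial.monomial δ c, monomial_mem hδ c⟩ ∈ B := by
    intro n
    induction n with
    | zero =>
      intro δ hδ c
      obtain rfl : δ = 0 := by rwa [expo_zero, Finsupp.degree_eq_zero_iff] at hδ
      exact (P.ofForm_zero_C c _).symm ▸ B.algebraMap_mem c
    | succ n ih =>
      intro δ hδ c
      obtain ⟨i, ε, hε, rfl⟩ := exists_eq_single_add_two_smul hδ
      have hi : (Finsupp.single i 1 : Fin (1 + 1) →₀ ℕ).degree = expo 2 1 := by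
        rw [Finsupp.degree_single, expo_one]
      have h := B.mul_mem (hone ⟨MvPolynomial.monomial (Finsupp.single i 1) 1, monomial_mem hi 1⟩)
        (ih ε hε c)
      rw [ofForm_mul] at h
      refine (P.ofForm_congr (add_comm 1 n) _ _ ?_) ▸ h
      change _ * MvPolynomial.expand (2 ^ 1) (MvPolynomial.monomial ε c) = _
      rw [pow_one, MvPolynomial.expand_monomial, MvPolynomial.monomial_mul, one_mul]
  rw [eq_top_iff]
  intro f _
  induction f using DirectSum.induction_on with
  | zero => exact B.zero_mem
  | add f g hf hg => exact B.add_mem (hf trivial) (hg trivial)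
  | of n a =>
    obtain ⟨g, rfl⟩ := (P.equiv n).symm.surjective a
    have hsum : g = ∑ δ ∈ g.1.support.attach, ⟨MvPolynomial.monomial δ.1 (g.1.coeff δ.1),
        monomial_mem (degree_eq_of_coeff_ne_zero g.2
          (MvPolynomial.mem_support_iff.1 δ.2)) _⟩ := by
      refine Subtype.ext ?_
      rw [Submodule.coe_sum, Finset.sum_attach _ fun δ => MvPolynomial.monomial δ (g.1.coeff δ)]
      exact g.1.as_sum
    rw [hsum, map_sum, map_sum]
    exact B.sum_mem fun δ _ => hmon n _ (degree_eq_of_coeff_ne_zero g.2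
      (MvPolynomial.mem_support_iff.1 δ.2)) _

end Generation

end FormPresentation

end FrobRing

end

theorem mainTheorem5 (p : ℕ) [Fact p.Prime] (k : Type*) [Field k] [CharP k p] [PerfectField k]
    (m : ℕ) (hm : 1 ≤ m) :
    (¬ (p = 2 ∧ m = 1) → ¬ Algebra.FiniteType k (FrobRing.TwistedRing k p m)) ∧
    (p = 2 ∧ m = 1 →
      Algebra.adjoin k (Set.range
        (DirectSum.lof k ℕ (fun n => FrobRing.piece k p m n) 1)) =
          (⊤ : Subalgebra k (FrobRing.TwistedRing k p m)) ∧
      ¬ IsNoetherianRing (FrobRing.TwistedRing k p m) ∧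
      ¬ IsNoetherianRing (FrobRing.TwistedRing k p m)ᵐᵒᵖ) := by
  have hp := (Fact.out : p.Prime)
  have P := FrobRing.twistedRingPresentation k p m hm
  refine ⟨fun h => P.not_finiteType hp hm h, ?_⟩
  rintro ⟨rfl, rfl⟩
  exact ⟨P.adjoin_degree_one_eq_top, P.not_isNoetherianRing le_rfl hm,
    P.not_isNoetherianRing_op le_rfl hm⟩
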